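/- Let $m,n\ge 1$ and $k\ge 0$ be integers, let $A\in\mathbb R^{m\times n}$, and let $\beta^1,\dots,\beta^k\in\mathbb R^n$ be linearly independent. For $\alpha=(\alpha^1,\dots,\alpha^k)\in(\mathbb R^m)^k$ let $G(\alpha)$ be the bimatrix game $\bigl(A,\,-A+\sum_{l=1}^k\alpha^l(\beta^l)^T\bigr)$, and let $\Gamma^k=\{G(\alpha) : \alpha\in(\mathbb R^m)^k\}\subset\mathbb R^{m\times n}\times\mathbb R^{m\times n}$. Let $\Delta_1\subset\mathbb R^m$ and $\Delta_2\subset\mathbb R^n$ be the simplices of mixed strategies, and let $$E_{\Gamma^k}=\{(\alpha,x,y)\in(\mathbb R^m)^k\times\Delta_1\times\Delta_2 : (x,y)\text{ is a Nash equilibrium of }G(\alpha)\}$$ be the Nash equilibrium correspondence of $\Gamma^k$. Consider the polyhedra $$P=\{(y,\pi_1)\in\mathbb R^{n+1} : (Ay)_i-\pi_1\le 0\ (1\le i\le m),\ y_j\ge 0\ (1\le j\le n),\ \textstyle\sum_j y_j=1\},$$ $$Q'^k=\{(x,\lambda,\pi_2)\in\mathbb R^{m+k+1} : x_i\ge 0\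 (1\le i\le m),\ -(x^TA)_j+\textstyle\sum_{l}\beta^l_j\lambda_l-\pi_2\le 0\ (1\le j\le n),\ \textstyle\sum_i x_i=1\},$$ of dimensions $n$ and $m+k$. Assume that both are non-degenerate: at each point of $P$ (respectively $Q'^k$) at most $n$ (respectively $m+k$) of the $m+n$ listed inequalities are tight, and exactly that many are tight if and only if the point is a vertex. Then $E_{\Gamma^k}$ is homeomorphic to $\Gamma^k$, and $\Gamma^k$ is homeomorphic to $\mathbb R^{km}$ (all with the subspace topologies). -/

import Mathlib

open scoped Matrix

/-- `(x, y)` is a Nash equilibrium, in mixed strategies, of the bimatrix game `(A, B)`. -/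
def IsNash {m n : ℕ} (A B : Matrix (Fin m) (Fin n) ℝ) (x : Fin m → ℝ) (y : Fin n → ℝ) : Prop :=
  x ∈ stdSimplex ℝ (Fin m) ∧ y ∈ stdSimplex ℝ (Fin n) ∧
    (∀ x' ∈ stdSimplex ℝ (Fin m), x' ⬝ᵥ (A *ᵥ y) ≤ x ⬝ᵥ (A *ᵥ y)) ∧
    (∀ y' ∈ stdSimplex ℝ (Fin n), x ⬝ᵥ (B *ᵥ y') ≤ x ⬝ᵥ (B *ᵥ y))

/-- The column player's payoff matrix `-A + ∑ l, α^l (β^l)ᵀ`. -/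
def colPayoff {m n k : ℕ} (A : Matrix (Fin m) (Fin n) ℝ) (β : Fin k → Fin n → ℝ)
    (α : Fin k → Fin m → ℝ) : Matrix (Fin m) (Fin n) ℝ :=
  -A + ∑ l, Matrix.vecMulVec (α l) (β l)

/-- The game space `Γ^k`, a set of pairs of payoff matrices. -/
def gameSpace {m n k : ℕ} (A : Matrix (Fin m) (Fin n) ℝ) (β : Fin k → Fin n → ℝ) :
    Set (Matrix (Fin m) (Fin n) ℝ × Matrix (Fin m) (Fin n) ℝ) :=
  {G | ∃ α : Fin k → Fin m → ℝ, G = (A, colPayoff A β α)}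

/-- The Nash equilibrium correspondence of `Γ^k`: all `(α, x, y)` such that `(x, y)` is a Nash
equilibrium of the game with parameter `α`. -/
def nashCorrespondence {m n k : ℕ} (A : Matrix (Fin m) (Fin n) ℝ) (β : Fin k → Fin n → ℝ) :
    Set ((Fin k → Fin m → ℝ) × (Fin m → ℝ) × (Fin n → ℝ)) :=
  {p | IsNash A (colPayoff A β p.1) p.2.1 p.2.2}

/-- The best response polyhedron `P` of the row player; a point is `(y, π₁)`. -/
def polyP {m n : ℕ} (A : Matrix (Fin m) (Fin n) ℝ) : Set ((Fin n → ℝ) × ℝ) :=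
  {v | (∀ i, (A *ᵥ v.1) i - v.2 ≤ 0) ∧ (∀ j, 0 ≤ v.1 j) ∧ ∑ j, v.1 j = 1}

/-- The inequalities of `polyP A` that are tight at `v`. -/
def labelP {m n : ℕ} (A : Matrix (Fin m) (Fin n) ℝ) (v : (Fin n → ℝ) × ℝ) :
    Set (Fin m ⊕ Fin n) :=
  {r | Sum.elim (fun i => (A *ᵥ v.1) i - v.2 = 0) (fun j => v.1 j = 0) r}

/-- The polyhedron `Q'^k`; a point is `(x, λ, π₂)`. -/
def polyQ {m n k : ℕ} (A : Matrix (Fin m) (Fin n) ℝ) (β : Fin k → Fin n → ℝ) :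
    Set ((Fin m → ℝ) × (Fin k → ℝ) × ℝ) :=
  {w | (∀ i, 0 ≤ w.1 i) ∧
    (∀ j, (w.1 ᵥ* (-A)) j + ∑ l, β l j * w.2.1 l - w.2.2 ≤ 0) ∧ ∑ i, w.1 i = 1}

/-- The inequalities of `polyQ A β` that are tight at `w`. -/
def labelQ {m n k : ℕ} (A : Matrix (Fin m) (Fin n) ℝ) (β : Fin k → Fin n → ℝ)
    (w : (Fin m → ℝ) × (Fin k → ℝ) × ℝ) : Set (Fin m ⊕ Fin n) :=
  {r | Sum.elim (fun i => w.1 i = 0)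
    (fun j => (w.1 ᵥ* (-A)) j + ∑ l, β l j * w.2.1 l - w.2.2 = 0) r}

/-- Non-degeneracy of a polyhedron `S` of dimension `d` described by finitely many inequalities,
`L v` being the set of those tight at `v`: at most `d` of them are tight at any point, and exactly
`d` are tight precisely at the vertices. -/
def Nondegenerate {E ι : Type*} [AddCommGroup E] [Module ℝ E] (S : Set E) (L : E → Set ι)
    (d : ℕ) : Prop :=
  ∀ v ∈ S, (L v).ncard ≤ d ∧ ((L v).ncard = d ↔ v ∈ S.extremePoints ℝ)

/-! Equilibria depend on `α` only through the expected values `c l = x ⬝ᵥ α l`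
(`isNash_colPayoff_iff`). The remaining conditions, `IsParametricOptimal`, describe a zero-sum game
with column bonuses weighted by `c`. Between `c` and the expected bonuses `g l = β l ⬝ᵥ y` they
define a monotone relation, and, as in Minty's theorem, every `z` splits as `c + g` in exactly one
way. Existence comes from a strongly convex function of `g` (`exists_isParametricOptimal`).
Monotonicity makes `c` and `g` unique (`IsParametricOptimal.param_eq`), and non-degeneracy, through
`Nondegenerate.tight_independent`, makes `(x, y)` unique (`IsParametricOptimal.unique`).

A Kohlberg–Mertens reparametrization then applies: keep the deviations of each `α l` from its mean
and replace the mean by `c l + g l`. To invert it, read `z` off the means, recover `(x, y)`, and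
shift each vector by a constant until its expected value is `z l - g l`. The inverse is continuous
because the solution map has a closed graph in a compact space. The game space is an injective
affine image of the parameter space. -/

/-! ### Independence of tight normals in non-degenerate polyhedra -/

section Polyhedron

variable {E ι : Type*} [AddCommGroup E] [Module ℝ E]

/-- From a point of a polyhedron one can move along a direction that keeps the tight inequalities
tight and meets another inequality, until a further inequality becomes tight. -/
theorem exists_mem_polyhedron_tight_ssubset [Finite ι] (a : ι → E →ₗ[ℝ] ℝ) (a₀ : E →ₗ[ℝ] ℝ)
    {v u : E} (hv : ∀ r, a r v ≤ 0) (hv₀ : a₀ v = 1) (hu : ∀ r, a r v = 0 → a r u = 0)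
    (hu₀ : a₀ u = 0) {r₀ : ι} (hr₀ : 0 < a r₀ u) :
    ∃ w, (∀ r, a r w ≤ 0) ∧ a₀ w = 1 ∧ {r | a r v = 0} ⊂ {r | a r w = 0} := by
  -- Ratio test: `r₁` is the first inequality to become tight along `v + t • u`.
  obtain ⟨r₁, hr₁, hmin⟩ := Set.exists_min_image {r | 0 < a r u} (fun r => -a r v / a r u)
    (Set.toFinite _) ⟨r₀, hr₀⟩
  have hr₁' : 0 < a r₁ u := hr₁
  set t := -a r₁ v / a r₁ u with ht
  have ht0 : 0 ≤ t := div_nonneg (neg_nonneg.2 (hv r₁)) hr₁'.le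
  refine ⟨v + t • u, fun r => ?_, by simp [hv₀, hu₀], ?_⟩
  · simp only [map_add, map_smul, smul_eq_mul]
    rcases le_or_gt (a r u) 0 with h | h
    · have := mul_nonneg_of_nonpos_of_nonpos (neg_nonpos.2 ht0) h
      linarith [hv r]
    · have := (le_div_iff₀ h).1 (hmin r h)
      linarith
  · refine (Set.ssubset_iff_of_subset fun r hr => ?_).2 ⟨r₁, ?_, fun h => ?_⟩
    · have hr' : a r v = 0 := hr
      simp [hr', hu r hr']
    · simp only [Set.mem_ofPred_eq, map_add, map_smul, smul_eq_mul, ht]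
      field_simp
      ring
    · exact hr₁'.ne' (hu r₁ h)

/-- In a non-degenerate polyhedron whose lineality space is at most one-dimensional, the normals of
the inequalities tight at a point are linearly independent. -/
theorem Nondegenerate.tight_independent [Fintype ι] [FiniteDimensional ℝ E]
    (a : ι → E →ₗ[ℝ] ℝ) (a₀ f : E →ₗ[ℝ] ℝ) {d : ℕ} (hd : Module.finrank ℝ E = d + 1)
    (hnd : Nondegenerate {v | (∀ r, a r v ≤ 0) ∧ a₀ v = 1} (fun v => {r | a r v = 0}) d)
    (hf : ∀ u, (∀ r, a r u = 0) → a₀ u = 0 → f u = 0 → u = 0)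
    {v : E} (hv : ∀ r, a r v ≤ 0) (hv₀ : a₀ v = 1)
    (c : ι → ℝ) (c₀ : ℝ) (hc : ∀ r, a r v ≠ 0 → c r = 0)
    (h : ∀ u, ∑ r, c r * a r u + c₀ * a₀ u = 0) : c = 0 ∧ c₀ = 0 := by
  classical
  -- Pass to a point `w` whose tight set is maximal above that of `v`. By maximality, every
  -- direction preserving the tight set of `w` lies in the lineality space.
  obtain ⟨T, hT, hmax⟩ := (Set.toFinite
    {T : Set ι | ∃ w, (∀ r, a r w ≤ 0) ∧ a₀ w = 1 ∧ T = {r | a r w = 0}}).exists_le_maximal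
    (a := {r | a r v = 0}) ⟨v, hv, hv₀, rfl⟩
  obtain ⟨w, hw, hw₀, rfl⟩ := hmax.prop
  have hpos : ∀ u, (∀ r, a r w = 0 → a r u = 0) → a₀ u = 0 → ∀ r, a r u ≤ 0 := by
    intro u hu hu₀ r
    by_contra! hr
    obtain ⟨w', h1, h2, h3⟩ := exists_mem_polyhedron_tight_ssubset a a₀ hw hw₀ hu hu₀ hr
    exact h3.2 (hmax.le_of_ge ⟨w', h1, h2, rfl⟩ h3.1)
  have hlin : ∀ u, (∀ r, a r w = 0 → a r u = 0) → a₀ u = 0 → ∀ r, a r u = 0 := by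
    intro u hu hu₀ r
    refine le_antisymm (hpos u hu hu₀ r) ?_
    have := hpos (-u) (fun r hr => by simp [hu r hr]) (by simp [hu₀]) r
    simpa using this
  let F : E →ₗ[ℝ] ({r // a r w = 0} → ℝ) × ℝ :=
    (LinearMap.pi fun r : {r // a r w = 0} => a r).prod a₀
  have hker : ∀ u ∈ LinearMap.ker F, (∀ r, a r u = 0) ∧ a₀ u = 0 := by
    intro u hu
    have hu' : F u = 0 := hu
    have h1 : ∀ r, a r w = 0 → a r u = 0 := fun r hr =>
      congrFun (congrArg Prod.fst hu') ⟨r, hr⟩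
    have h2 : a₀ u = 0 := congrArg Prod.snd hu'
    exact ⟨hlin u h1 h2, h2⟩
  have hcard : Set.ncard {r | a r w = 0} = Fintype.card {r // a r w = 0} := by
    rw [← Nat.card_coe_set_eq, Nat.card_eq_fintype_card]
    rfl
  have hrank := LinearMap.finrank_range_add_finrank_ker F
  have hker1 : Module.finrank ℝ (LinearMap.ker F) ≤ 1 := by
    have := LinearMap.finrank_le_finrank_of_injective
      (f := f.comp (LinearMap.ker F).subtype) (by
        rw [← LinearMap.ker_eq_bot, LinearMap.ker_eq_bot']
        rintro ⟨u, hu⟩ hfu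
        exact Subtype.ext (hf u (hker u hu).1 (hker u hu).2 hfu))
    simpa using this
  -- The rank of `F` is `d + 1` minus the dimension of its kernel. If the kernel is a line, `w` is
  -- the midpoint of `w - u` and `w + u`, so it is no vertex and has fewer than `d` tight
  -- inequalities, which makes up for the lost rank.
  have hle : Fintype.card {r // a r w = 0} + 1 ≤ Module.finrank ℝ (LinearMap.range F) := by
    obtain ⟨hle, hiff⟩ := hnd w ⟨hw, hw₀⟩
    simp only [hcard] at hle hiff
    by_cases hbot : LinearMap.ker F = ⊥
    · rw [hbot, finrank_bot] at hrank
      omega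
    · obtain ⟨u, hu, hu0⟩ := (Submodule.ne_bot_iff _).1 hbot
      obtain ⟨h1, h2⟩ := hker u hu
      have hne : Fintype.card {r // a r w = 0} ≠ d := fun heq => by
        have hext := (hiff.1 heq).2 (x₁ := w - u) ⟨by simpa [h1] using hw, by simp [h2, hw₀]⟩
          (x₂ := w + u) ⟨by simpa [h1] using hw, by simp [h2, hw₀]⟩
          ⟨1 / 2, 1 / 2, by norm_num, by norm_num, by norm_num, by module⟩
        exact hu0 (by simpa using hext)
      omega
  have hsurj : Function.Surjective F := by
    rw [← LinearMap.range_eq_top]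
    apply Submodule.eq_top_of_finrank_eq
    refine le_antisymm (Submodule.finrank_le _) ?_
    simpa using hle
  -- Evaluated at a `u` where the tight functionals take the values of the coefficients themselves,
  -- the relation becomes a vanishing sum of squares.
  obtain ⟨u, hu⟩ := hsurj (fun r => c r, c₀)
  have hu1 : ∀ r, a r w = 0 → a r u = c r := fun r hr =>
    congrFun (congrArg Prod.fst hu) ⟨r, hr⟩
  have hu2 : a₀ u = c₀ := congrArg Prod.snd hu
  have key : ∑ r, c r * c r + c₀ * c₀ = 0 := by
    rw [← h u, hu2]
    congr 1
    refine Finset.sum_congr rfl fun r _ => ?_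
    by_cases hr : a r v = 0
    · rw [hu1 r (hT hr)]
    · simp [hc r hr]
  have hs : 0 ≤ ∑ r, c r * c r := Finset.sum_nonneg fun r _ => mul_self_nonneg _
  have hs0 : ∑ r, c r * c r = 0 := by nlinarith [mul_self_nonneg c₀]
  refine ⟨funext fun r => ?_, by nlinarith⟩
  have := (Finset.sum_eq_zero_iff_of_nonneg fun r _ => mul_self_nonneg (c r)).1 hs0 r
    (Finset.mem_univ r)
  simpa using this

end Polyhedron

/-- The optimality conditions of the linear program with parameter `c`: `x` and `y` are mixed
strategies, `x` is a best response to `y` in `A`, and `y` is a best response to `x` when the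
column player receives `-A` together with the bonus `∑ l, c l * β l j` for the column `j`. -/
structure IsParametricOptimal {m n k : ℕ} (A : Matrix (Fin m) (Fin n) ℝ) (β : Fin k → Fin n → ℝ)
    (c : Fin k → ℝ) (x : Fin m → ℝ) (y : Fin n → ℝ) : Prop where
  left_mem : x ∈ stdSimplex ℝ (Fin m)
  right_mem : y ∈ stdSimplex ℝ (Fin n)
  row_le : ∀ i, (A *ᵥ y) i ≤ x ⬝ᵥ (A *ᵥ y)
  col_le : ∀ j, (x ᵥ* (-A)) j + ∑ l, β l j * c l ≤ -(x ⬝ᵥ (A *ᵥ y)) + ∑ l, c l * (β l ⬝ᵥ y)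

/-! ### Complementary slackness and separation on the simplex -/

section Simplex

variable {ι : Type*} [Fintype ι]

theorem dotProduct_le_of_mem_stdSimplex {x f : ι → ℝ} (hx : x ∈ stdSimplex ℝ ι) {b : ℝ}
    (h : ∀ i, f i ≤ b) : x ⬝ᵥ f ≤ b :=
  calc x ⬝ᵥ f ≤ ∑ i, x i * b := Finset.sum_le_sum fun i _ => mul_le_mul_of_nonneg_left (h i) (hx.1 i)
    _ = b := by rw [← Finset.sum_mul, hx.2, one_mul]

/-- Complementary slackness: a weighted average reaches the upper bound only if every entry with
positive weight does. -/
theorem eq_of_dotProduct_eq_of_mem_stdSimplex {x f : ι → ℝ} (hx : x ∈ stdSimplex ℝ ι) {b : ℝ}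
    (h : ∀ i, f i ≤ b) (hb : x ⬝ᵥ f = b) {i : ι} (hi : x i ≠ 0) : f i = b := by
  have hsum : ∑ i, x i * (b - f i) = 0 := by
    simp only [mul_sub, Finset.sum_sub_distrib, ← Finset.sum_mul, hx.2]
    rw [one_mul, sub_eq_zero, ← hb]
    rfl
  have := (Finset.sum_eq_zero_iff_of_nonneg fun i _ =>
    mul_nonneg (hx.1 i) (sub_nonneg.2 (h i))).1 hsum i (Finset.mem_univ i)
  rcases mul_eq_zero.1 this with h0 | h0
  · exact absurd h0 hi
  · linarith

/-- A convex set all of whose points have a coordinate at least `s` lies on one side of a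
hyperplane with normal in the simplex. -/
theorem exists_mem_stdSimplex_forall_le_dotProduct {K : Set (ι → ℝ)} (hK : Convex ℝ K)
    (hne : K.Nonempty) {s : ℝ} (h : ∀ z ∈ K, ∃ i, s ≤ z i) :
    ∃ x ∈ stdSimplex ℝ ι, ∀ z ∈ K, s ≤ x ⬝ᵥ z := by
  classical
  have hU : {z : ι → ℝ | ∀ i, z i < s} = Set.univ.pi fun _ => Set.Iio s := by
    ext z; simp
  -- Separate `K` from the open orthant below `s`. The orthant is unbounded downwards, which forces
  -- the normal to be nonnegative.
  obtain ⟨f, u, hfU, hfK⟩ := geometric_hahn_banach_open (s := {z : ι → ℝ | ∀ i, z i < s}) (t := K)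
    (by rw [hU]; exact convex_pi fun _ _ => convex_Iio s)
    (by rw [hU]; exact isOpen_set_pi Set.finite_univ fun _ _ => isOpen_Iio)
    hK (Set.disjoint_left.2 fun z hz hzK => by
      obtain ⟨i, hi⟩ := h z hzK
      exact absurd (hz i) (not_lt.2 hi))
  set x : ι → ℝ := fun i => f (Pi.single i 1) with hx
  have hf : ∀ z, f z = x ⬝ᵥ z := by
    intro z
    conv_lhs => rw [pi_eq_sum_univ' z]
    simp [hx, dotProduct, map_sum, mul_comm]
  have hconst : ∀ b : ℝ, b < s → b * ∑ i, x i < u := by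
    intro b hb
    have := hfU (fun _ => b) fun _ => hb
    rw [hf] at this
    simpa [dotProduct, Finset.mul_sum, mul_comm] using this
  have hnonneg : ∀ i, 0 ≤ x i := by
    intro i
    by_contra! hi
    have hlt : ∀ t : ℝ, 0 ≤ t → (s - 1) * ∑ i, x i - t * x i < u := by
      intro t ht
      have := hfU ((fun _ => s - 1) - t • Pi.single i 1) fun j => by
        have : 0 ≤ (Pi.single i (1 : ℝ) : ι → ℝ) j := by
          by_cases hj : j = i
          · subst hj; simp
          · simp [hj]
        simp only [Pi.sub_apply, Pi.smul_apply, smul_eq_mul]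
        nlinarith
      rw [map_sub, map_smul, hf (fun _ => s - 1)] at this
      simpa [dotProduct, Finset.mul_sum, mul_comm, hx] using this
    have h0 := hlt 0 le_rfl
    -- This `t` makes the left side of `hlt` equal to `u`, contradicting strictness.
    have h1 := hlt ((u - (s - 1) * ∑ i, x i) / (-x i)) (div_nonneg (by linarith) (by linarith))
    have : (u - (s - 1) * ∑ i, x i) / (-x i) * x i = -(u - (s - 1) * ∑ i, x i) := by
      rw [div_neg, neg_mul, div_mul_cancel₀ _ hi.ne]
    linarith
  have hpos : 0 < ∑ i, x i := by
    refine lt_of_le_of_ne (Finset.sum_nonneg fun i _ => hnonneg i) fun h0 => ?_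
    have hx0 : ∀ i, x i = 0 := fun i =>
      (Finset.sum_eq_zero_iff_of_nonneg fun i _ => hnonneg i).1 h0.symm i (Finset.mem_univ i)
    obtain ⟨z, hz⟩ := hne
    have h1 := hfK z hz
    have h2 := hconst (s - 1) (by linarith)
    rw [hf] at h1
    simp only [dotProduct, hx0, zero_mul, Finset.sum_const_zero, mul_zero] at h1 h2
    linarith
  have hsu : s * ∑ i, x i ≤ u := by
    rw [← le_div_iff₀ hpos]
    refine le_of_forall_lt fun b hb => ?_
    rw [lt_div_iff₀ hpos]
    exact hconst b hb
  refine ⟨(∑ i, x i)⁻¹ • x, ⟨fun i => ?_, ?_⟩, fun z hz => ?_⟩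
  · exact mul_nonneg (inv_nonneg.2 hpos.le) (hnonneg i)
  · simp only [Pi.smul_apply, smul_eq_mul, ← Finset.mul_sum]
    exact inv_mul_cancel₀ hpos.ne'
  · rw [smul_dotProduct, smul_eq_mul, ← div_eq_inv_mul, le_div_iff₀ hpos, ← hf]
    exact hsu.trans (hfK z hz)

end Simplex

/-! ### Parametric optimality, monotonicity, and the two polyhedra -/

section Optimal

variable {m n k : ℕ} {A : Matrix (Fin m) (Fin n) ℝ} {β : Fin k → Fin n → ℝ}
  {c c' : Fin k → ℝ} {x x' : Fin m → ℝ} {y y' : Fin n → ℝ}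

theorem dotProduct_bonus (A : Matrix (Fin m) (Fin n) ℝ) (β : Fin k → Fin n → ℝ) (c : Fin k → ℝ)
    (x : Fin m → ℝ) (y : Fin n → ℝ) :
    y ⬝ᵥ (fun j => (x ᵥ* (-A)) j + ∑ l, β l j * c l) =
      -(x ⬝ᵥ (A *ᵥ y)) + ∑ l, c l * (β l ⬝ᵥ y) := by
  have h1 : y ⬝ᵥ (x ᵥ* (-A)) = -(x ⬝ᵥ (A *ᵥ y)) := by
    rw [dotProduct_comm, ← Matrix.dotProduct_mulVec, Matrix.neg_mulVec, dotProduct_neg]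
  have h2 : y ⬝ᵥ (fun j => ∑ l, β l j * c l) = ∑ l, c l * (β l ⬝ᵥ y) := by
    simp only [dotProduct, Finset.mul_sum]
    rw [Finset.sum_comm]
    exact Finset.sum_congr rfl fun l _ => Finset.sum_congr rfl fun j _ => by ring
  rw [← h1, ← h2, ← dotProduct_add]
  rfl

theorem IsParametricOptimal.le_left (h : IsParametricOptimal A β c x y)
    (hx' : x' ∈ stdSimplex ℝ (Fin m)) : x' ⬝ᵥ (A *ᵥ y) ≤ x ⬝ᵥ (A *ᵥ y) :=
  dotProduct_le_of_mem_stdSimplex hx' h.row_le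

theorem IsParametricOptimal.le_right (h : IsParametricOptimal A β c x y)
    (hy' : y' ∈ stdSimplex ℝ (Fin n)) :
    -(x ⬝ᵥ (A *ᵥ y')) + ∑ l, c l * (β l ⬝ᵥ y') ≤ -(x ⬝ᵥ (A *ᵥ y)) + ∑ l, c l * (β l ⬝ᵥ y) := by
  rw [← dotProduct_bonus]
  exact dotProduct_le_of_mem_stdSimplex hy' h.col_le

theorem dotProduct_colPayoff_mulVec (A : Matrix (Fin m) (Fin n) ℝ) (β : Fin k → Fin n → ℝ)
    (α : Fin k → Fin m → ℝ) (x : Fin m → ℝ) (y : Fin n → ℝ) :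
    x ⬝ᵥ (colPayoff A β α *ᵥ y) = -(x ⬝ᵥ (A *ᵥ y)) + ∑ l, (x ⬝ᵥ α l) * (β l ⬝ᵥ y) := by
  simp only [colPayoff, Matrix.add_mulVec, Matrix.neg_mulVec, dotProduct_add, dotProduct_neg,
    Matrix.sum_mulVec, dotProduct_sum, Matrix.vecMulVec_mulVec]
  congr 1
  refine Finset.sum_congr rfl fun l _ => ?_
  simp [dotProduct, Finset.sum_mul, mul_assoc]

/-- The Nash equilibria of the game with parameter `α` depend on `α` only through the expected
values `x ⬝ᵥ α l`. -/
theorem isNash_colPayoff_iff {α : Fin k → Fin m → ℝ} :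
    IsNash A (colPayoff A β α) x y ↔ IsParametricOptimal A β (fun l => x ⬝ᵥ α l) x y := by
  constructor
  · rintro ⟨hx, hy, h1, h2⟩
    refine ⟨hx, hy, fun i => ?_, fun j => ?_⟩
    · simpa using h1 (Pi.single i 1) (single_mem_stdSimplex ℝ i)
    · have := h2 (Pi.single j 1) (single_mem_stdSimplex ℝ j)
      rw [dotProduct_colPayoff_mulVec, dotProduct_colPayoff_mulVec, ← dotProduct_bonus] at this
      simpa using this
  · intro h
    refine ⟨h.left_mem, h.right_mem, fun x' hx' => h.le_left hx', fun y' hy' => ?_⟩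
    rw [dotProduct_colPayoff_mulVec, dotProduct_colPayoff_mulVec]
    exact h.le_right hy'

/-- Minty monotonicity: the parameter and the expected bonuses of two optimal pairs can only agree
in sum if they agree separately. -/
theorem IsParametricOptimal.param_eq (h : IsParametricOptimal A β c x y)
    (h' : IsParametricOptimal A β c' x' y') (he : ∀ l, c l + β l ⬝ᵥ y = c' l + β l ⬝ᵥ y') :
    c = c' := by
  have h1 := h.le_right h'.right_mem
  have h2 := h'.le_right h.right_mem
  have h3 := h.le_left h'.left_mem
  have h4 := h'.le_left h.left_mem
  -- By `he`, `c - c'` is the negative of the difference of the bonuses, so its squared norm is a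
  -- cross term. The four optimality inequalities make that term nonpositive.
  have key : ∑ l, (c l - c' l) ^ 2 = (∑ l, c l * (β l ⬝ᵥ y') + ∑ l, c' l * (β l ⬝ᵥ y)) -
      (∑ l, c l * (β l ⬝ᵥ y) + ∑ l, c' l * (β l ⬝ᵥ y')) := by
    simp only [← Finset.sum_add_distrib, ← Finset.sum_sub_distrib]
    refine Finset.sum_congr rfl fun l _ => ?_
    linear_combination (c l - c' l) * he l
  have h0 : ∑ l, (c l - c' l) ^ 2 = 0 :=
    le_antisymm (by rw [key]; linarith) (Finset.sum_nonneg fun l _ => sq_nonneg _)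
  funext l
  have := (Finset.sum_eq_zero_iff_of_nonneg fun l _ => sq_nonneg (c l - c' l)).1 h0 l
    (Finset.mem_univ l)
  exact sub_eq_zero.1 (pow_eq_zero_iff two_ne_zero |>.1 this)

theorem polyP_independent (hP : Nondegenerate (polyP A) (labelP A) n)
    {v : (Fin n → ℝ) × ℝ} (hv : v ∈ polyP A) (p : Fin m → ℝ) (q : Fin n → ℝ)
    (hp : ∀ i, (A *ᵥ v.1) i ≠ v.2 → p i = 0) (hq : ∀ j, v.1 j ≠ 0 → q j = 0)
    (h : ∀ u : (Fin n → ℝ) × ℝ, ∑ i, p i * ((A *ᵥ u.1) i - u.2) = ∑ j, q j * u.1 j) :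
    p = 0 := by
  let a : Fin m ⊕ Fin n → ((Fin n → ℝ) × ℝ) →ₗ[ℝ] ℝ := Sum.elim
    (fun i => (LinearMap.proj i ∘ₗ A.mulVecLin) ∘ₗ LinearMap.fst ℝ _ _ - LinearMap.snd ℝ _ _)
    (fun j => -(LinearMap.proj j ∘ₗ LinearMap.fst ℝ _ _))
  let a₀ : ((Fin n → ℝ) × ℝ) →ₗ[ℝ] ℝ := (∑ j, LinearMap.proj j) ∘ₗ LinearMap.fst ℝ _ _
  have e1 : polyP A = {v | (∀ r, a r v ≤ 0) ∧ a₀ v = 1} := by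
    ext w
    simp [polyP, a, a₀, and_assoc]
  have e2 : labelP A = fun v => {r | a r v = 0} := by
    funext w
    ext r
    cases r <;> simp [labelP, a]
  rw [e1, e2] at hP
  rw [e1] at hv
  have := (hP.tight_independent a a₀ (LinearMap.snd ℝ _ _) (by simp) (fun u hu _ hf => by
      refine Prod.ext (funext fun j => ?_) hf
      simpa [a] using hu (Sum.inr j)) hv.1 hv.2 (Sum.elim p q) 0 (by
      rintro (i | j) hr
      · exact hp i fun h0 => hr (by simp [a, h0])
      · exact hq j fun h0 => hr (by simp [a, h0])) (fun u => by
      simp [a, h u])).1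
  exact funext fun i => congrFun this (Sum.inl i)

/-- The lineality space of the polyhedron is a line when the all-ones vector lies in the span of
`β`. The coordinate `π₂` is injective on it, since `x = 0` and `π₂ = 0` force `λ = 0` by
independence of `β`. -/
theorem polyQ_independent (hQ : Nondegenerate (polyQ A β) (labelQ A β) (m + k))
    (hβ : LinearIndependent ℝ β)
    {w : (Fin m → ℝ) × (Fin k → ℝ) × ℝ} (hw : w ∈ polyQ A β) (p : Fin m → ℝ) (q : Fin n → ℝ)
    (hp : ∀ i, w.1 i ≠ 0 → p i = 0)
    (hq : ∀ j, (w.1 ᵥ* (-A)) j + ∑ l, β l j * w.2.1 l ≠ w.2.2 → q j = 0)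
    (h : ∀ u : (Fin m → ℝ) × (Fin k → ℝ) × ℝ,
      ∑ j, q j * ((u.1 ᵥ* (-A)) j + ∑ l, β l j * u.2.1 l - u.2.2) = ∑ i, p i * u.1 i) :
    q = 0 := by
  let a : Fin m ⊕ Fin n → ((Fin m → ℝ) × (Fin k → ℝ) × ℝ) →ₗ[ℝ] ℝ := Sum.elim
    (fun i => -(LinearMap.proj i ∘ₗ LinearMap.fst ℝ _ _))
    (fun j => (LinearMap.proj j ∘ₗ (-A).vecMulLinear) ∘ₗ LinearMap.fst ℝ _ _ +
      ((∑ l, β l j • LinearMap.proj l) ∘ₗ LinearMap.fst ℝ _ _) ∘ₗ LinearMap.snd ℝ _ _ -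
      LinearMap.snd ℝ _ _ ∘ₗ LinearMap.snd ℝ _ _)
  let a₀ : ((Fin m → ℝ) × (Fin k → ℝ) × ℝ) →ₗ[ℝ] ℝ :=
    (∑ j, LinearMap.proj j) ∘ₗ LinearMap.fst ℝ _ _
  have ainl : ∀ i u, a (Sum.inl i) u = -u.1 i := fun i u => rfl
  have ainr : ∀ j u, a (Sum.inr j) u = (u.1 ᵥ* (-A)) j + ∑ l, β l j * u.2.1 l - u.2.2 := by
    intro j u
    simp [a, Matrix.vecMul_neg]
  have e1 : polyQ A β = {v | (∀ r, a r v ≤ 0) ∧ a₀ v = 1} := by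
    ext w
    simp only [polyQ, Set.mem_ofPred_eq, Sum.forall, ainl, ainr, and_assoc, neg_nonpos]
    simp [a₀]
  have e2 : labelQ A β = fun v => {r | a r v = 0} := by
    funext w
    ext r
    cases r <;> simp only [labelQ, Set.mem_ofPred_eq, ainl, ainr, Sum.elim_inl, Sum.elim_inr,
      neg_eq_zero]
  rw [e1, e2] at hQ
  rw [e1] at hw
  have := (hQ.tight_independent a a₀ (LinearMap.snd ℝ _ _ ∘ₗ LinearMap.snd ℝ _ _)
      (by simp [add_assoc]) (fun u hu _ hf => by
      have hf' : u.2.2 = 0 := hf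
      have h1 : u.1 = 0 := funext fun i => by simpa [ainl] using hu (Sum.inl i)
      have h2 : ∑ l, u.2.1 l • β l = 0 := by
        funext j
        have := hu (Sum.inr j)
        rw [ainr, h1, hf'] at this
        simpa [mul_comm] using this
      have h3 : u.2.1 = 0 := funext (Fintype.linearIndependent_iff.1 hβ _ h2)
      exact Prod.ext h1 (Prod.ext h3 hf')) hw.1 hw.2 (Sum.elim p q) 0 (by
      rintro (i | j) hr
      · exact hp i fun h0 => hr (by simp [ainl, h0])
      · exact hq j fun h0 => hr (by simp only [ainr, h0, sub_self])) (fun u => by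
      simp [ainl, ainr, h u])).1
  exact funext fun j => congrFun this (Sum.inr j)

end Optimal

/-! ### Uniqueness and existence of optimal pairs -/

section Optimal

variable {m n k : ℕ} {A : Matrix (Fin m) (Fin n) ℝ} {β : Fin k → Fin n → ℝ}
  {c c' : Fin k → ℝ} {x x' : Fin m → ℝ} {y y' : Fin n → ℝ}

theorem IsParametricOptimal.mem_polyP (h : IsParametricOptimal A β c x y) :
    (y, x ⬝ᵥ (A *ᵥ y)) ∈ polyP A :=
  ⟨fun i => sub_nonpos.2 (h.row_le i), h.right_mem.1, h.right_mem.2⟩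

theorem IsParametricOptimal.mem_polyQ (h : IsParametricOptimal A β c x y) :
    (x, c, -(x ⬝ᵥ (A *ᵥ y)) + ∑ l, c l * (β l ⬝ᵥ y)) ∈ polyQ A β :=
  ⟨h.left_mem.1, fun j => sub_nonpos.2 (h.col_le j), h.left_mem.2⟩

/-- Under non-degeneracy an optimal pair is determined by the sum of the parameter and the expected
bonuses. -/
theorem IsParametricOptimal.unique (hP : Nondegenerate (polyP A) (labelP A) n)
    (hQ : Nondegenerate (polyQ A β) (labelQ A β) (m + k)) (hβ : LinearIndependent ℝ β)
    (h : IsParametricOptimal A β c x y)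
    (h' : IsParametricOptimal A β c' x' y') (he : ∀ l, c l + β l ⬝ᵥ y = c' l + β l ⬝ᵥ y') :
    x = x' ∧ y = y' := by
  obtain rfl := h.param_eq h' he
  have hg : ∀ l, β l ⬝ᵥ y = β l ⬝ᵥ y' := fun l => by linarith [he l]
  have h1 := h.le_right h'.right_mem
  have h2 := h'.le_right h.right_mem
  have h3 := h.le_left h'.left_mem
  have h4 := h'.le_left h.left_mem
  simp only [hg] at h1 h2
  set r := x ⬝ᵥ (A *ᵥ y) with hr
  -- With equal bonuses the four inequalities close into a cycle, so the two optimal pairs are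
  -- interchangeable.
  have e1 : x ⬝ᵥ (A *ᵥ y') = r := by linarith
  have e2 : x' ⬝ᵥ (A *ᵥ y) = r := by linarith
  have e3 : x' ⬝ᵥ (A *ᵥ y') = r := by linarith
  have row := h.row_le
  have row' := h'.row_le
  have col := h.col_le
  have col' := h'.col_le
  have memP := h.mem_polyP
  have memQ := h.mem_polyQ
  have memP' := h'.mem_polyP
  have memQ' := h'.mem_polyQ
  rw [← hr] at row col memP memQ
  rw [e3] at row' col' memP' memQ'
  have hq : ∑ l, c l * (β l ⬝ᵥ y) = ∑ l, c l * (β l ⬝ᵥ y') := by simp only [hg]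
  rw [← hq] at col' memQ'
  set q := -r + ∑ l, c l * (β l ⬝ᵥ y) with hqdef
  have rx : ∀ i, x i ≠ 0 → (A *ᵥ y) i = r := fun i =>
    eq_of_dotProduct_eq_of_mem_stdSimplex h.left_mem row hr.symm
  have rx' : ∀ i, x i ≠ 0 → (A *ᵥ y') i = r := fun i =>
    eq_of_dotProduct_eq_of_mem_stdSimplex h.left_mem row' e1
  have r'x : ∀ i, x' i ≠ 0 → (A *ᵥ y) i = r := fun i =>
    eq_of_dotProduct_eq_of_mem_stdSimplex h'.left_mem row e2
  have r'x' : ∀ i, x' i ≠ 0 → (A *ᵥ y') i = r := fun i =>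
    eq_of_dotProduct_eq_of_mem_stdSimplex h'.left_mem row' e3
  have cy : ∀ j, y j ≠ 0 → (x ᵥ* (-A)) j + ∑ l, β l j * c l = q := fun j =>
    eq_of_dotProduct_eq_of_mem_stdSimplex h.right_mem col (by rw [dotProduct_bonus])
  have cy' : ∀ j, y' j ≠ 0 → (x ᵥ* (-A)) j + ∑ l, β l j * c l = q := fun j =>
    eq_of_dotProduct_eq_of_mem_stdSimplex h'.right_mem col (by rw [dotProduct_bonus, e1, ← hq])
  have c'y : ∀ j, y j ≠ 0 → (x' ᵥ* (-A)) j + ∑ l, β l j * c l = q := fun j =>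
    eq_of_dotProduct_eq_of_mem_stdSimplex h.right_mem col' (by rw [dotProduct_bonus, e2])
  have c'y' : ∀ j, y' j ≠ 0 → (x' ᵥ* (-A)) j + ∑ l, β l j * c l = q := fun j =>
    eq_of_dotProduct_eq_of_mem_stdSimplex h'.right_mem col' (by rw [dotProduct_bonus, e3, ← hq])
  constructor
  -- At the midpoint of `y` and `y'`, every row in the support of `x` or `x'` is tight, and a
  -- coordinate vanishes only where both strategies do. Hence `x - x'` gives a linear relation among
  -- tight normals.
  · have hv : ((1 / 2 : ℝ) • (y + y'), r) ∈ polyP A := by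
      refine ⟨fun i => ?_, fun j => ?_, ?_⟩
      · simp only [Matrix.mulVec_smul, Matrix.mulVec_add, Pi.smul_apply, Pi.add_apply, smul_eq_mul]
        linarith [row i, row' i]
      · have a1 := memP.2.1 j
        have a2 := memP'.2.1 j
        simp only [Pi.smul_apply, Pi.add_apply, smul_eq_mul] at *
        linarith
      · have a1 := memP.2.2
        have a2 := memP'.2.2
        simp only [Pi.smul_apply, Pi.add_apply, smul_eq_mul, ← Finset.mul_sum,
          Finset.sum_add_distrib] at *
        linarith
    refine sub_eq_zero.1 (polyP_independent hP hv (x - x') ((x - x') ᵥ* A) ?_ ?_ ?_)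
    · intro i hi
      by_cases hx : x i = 0
      · by_cases hx' : x' i = 0
        · simp [hx, hx']
        · refine absurd ?_ hi
          simp only [Matrix.mulVec_smul, Matrix.mulVec_add, Pi.smul_apply, Pi.add_apply,
            smul_eq_mul, r'x i hx', r'x' i hx']
          ring
      · refine absurd ?_ hi
        simp only [Matrix.mulVec_smul, Matrix.mulVec_add, Pi.smul_apply, Pi.add_apply,
          smul_eq_mul, rx i hx, rx' i hx]
        ring
    · intro j hj
      have : (x ᵥ* (-A)) j = (x' ᵥ* (-A)) j := by
        by_cases hy : y j = 0
        · have hy' : y' j ≠ 0 := fun hy' => hj (by simp [hy, hy'])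
          linarith [cy' j hy', c'y' j hy']
        · linarith [cy j hy, c'y j hy]
      simp only [Matrix.vecMul_neg, Pi.neg_apply, neg_inj] at this
      simp [Matrix.sub_vecMul, this]
    · intro u
      have s1 : ∑ i, (x - x') i * u.2 = 0 := by
        rw [← Finset.sum_mul]
        simp [h.left_mem.2, h'.left_mem.2]
      calc ∑ i, (x - x') i * ((A *ᵥ u.1) i - u.2)
          = (x - x') ⬝ᵥ (A *ᵥ u.1) - ∑ i, (x - x') i * u.2 := by
            simp only [mul_sub, Finset.sum_sub_distrib, dotProduct]
        _ = ((x - x') ᵥ* A) ⬝ᵥ u.1 := by rw [s1, sub_zero, Matrix.dotProduct_mulVec]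
        _ = _ := rfl
  -- Dual argument at the midpoint of `x` and `x'`. The `λ`-terms of the relation given by `y - y'`
  -- cancel because the bonuses agree.
  · have hw : ((1 / 2 : ℝ) • (x + x'), c, q) ∈ polyQ A β := by
      refine ⟨fun i => ?_, fun j => ?_, ?_⟩
      · have a1 := memQ.1 i
        have a2 := memQ'.1 i
        simp only [Pi.smul_apply, Pi.add_apply, smul_eq_mul] at *
        linarith
      · simp only [Matrix.smul_vecMul, Matrix.add_vecMul, Pi.smul_apply, Pi.add_apply, smul_eq_mul]
        linarith [col j, col' j]
      · have a1 := memQ.2.2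
        have a2 := memQ'.2.2
        simp only [Pi.smul_apply, Pi.add_apply, smul_eq_mul, ← Finset.mul_sum,
          Finset.sum_add_distrib] at *
        linarith
    refine sub_eq_zero.1 (polyQ_independent hQ hβ hw (-(A *ᵥ (y - y'))) (y - y') ?_ ?_ ?_)
    · intro i hi
      have : (A *ᵥ y) i = (A *ᵥ y') i := by
        by_cases hx : x i = 0
        · have hx' : x' i ≠ 0 := fun hx' => hi (by simp [hx, hx'])
          rw [r'x i hx', r'x' i hx']
        · rw [rx i hx, rx' i hx]
      simp [Matrix.mulVec_sub, this]
    · intro j hj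
      by_cases hy : y j = 0
      · by_cases hy' : y' j = 0
        · simp [hy, hy']
        · refine absurd ?_ hj
          simp only [Matrix.smul_vecMul, Matrix.add_vecMul, Pi.smul_apply, Pi.add_apply,
            smul_eq_mul]
          linarith [cy' j hy', c'y' j hy']
      · refine absurd ?_ hj
        simp only [Matrix.smul_vecMul, Matrix.add_vecMul, Pi.smul_apply, Pi.add_apply, smul_eq_mul]
        linarith [cy j hy, c'y j hy]
    · intro u
      have s1 : ∑ j, (y - y') j * u.2.2 = 0 := by
        rw [← Finset.sum_mul]
        simp [h.right_mem.2, h'.right_mem.2]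
      have s2 : ∑ l, u.2.1 l * (β l ⬝ᵥ (y - y')) = 0 := by simp [dotProduct_sub, hg]
      calc ∑ j, (y - y') j * ((u.1 ᵥ* (-A)) j + ∑ l, β l j * u.2.1 l - u.2.2)
          = (y - y') ⬝ᵥ (fun j => (u.1 ᵥ* (-A)) j + ∑ l, β l j * u.2.1 l) -
            ∑ j, (y - y') j * u.2.2 := by
            simp only [mul_sub, Finset.sum_sub_distrib, dotProduct]
        _ = -(u.1 ⬝ᵥ (A *ᵥ (y - y'))) := by
            rw [s1, sub_zero, dotProduct_bonus, s2, add_zero]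
        _ = (-(A *ᵥ (y - y'))) ⬝ᵥ u.1 := by rw [neg_dotProduct, dotProduct_comm]
        _ = _ := rfl

/-- For every `z` there is an optimal pair whose parameter and expected bonuses sum to `z`: its
second component minimizes the largest payoff of a row plus a strongly convex function of the
bonuses. -/
theorem exists_isParametricOptimal (hm : 0 < m) (hn : 0 < n) (A : Matrix (Fin m) (Fin n) ℝ)
    (β : Fin k → Fin n → ℝ) (z : Fin k → ℝ) :
    ∃ x y, IsParametricOptimal A β (fun l => z l - β l ⬝ᵥ y) x y := by
  have : Nonempty (Fin m) := ⟨⟨0, hm⟩⟩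
  have : Nonempty (Fin n) := ⟨⟨0, hn⟩⟩
  let M : (Fin n → ℝ) → ℝ := fun y => Finset.univ.sup' Finset.univ_nonempty fun i => (A *ᵥ y) i
  have leM : ∀ y i, (A *ᵥ y) i ≤ M y := fun y i =>
    Finset.le_sup' (fun i => (A *ᵥ y) i) (Finset.mem_univ i)
  let ψ : (Fin n → ℝ) → ℝ := fun y => M y + ∑ l, ((β l ⬝ᵥ y) ^ 2 / 2 - z l * (β l ⬝ᵥ y))
  have hM : Continuous M := by
    refine Continuous.finset_sup'_apply _ fun i _ => ?_
    exact (continuous_apply i).comp (Continuous.matrix_mulVec continuous_const continuous_id)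
  have hψ : Continuous ψ := by
    refine hM.add (continuous_finsetSum _ fun l _ => ?_)
    have : Continuous fun y : Fin n → ℝ => β l ⬝ᵥ y := Continuous.dotProduct continuous_const continuous_id
    fun_prop
  obtain ⟨y, hy, hmin⟩ := (isCompact_stdSimplex ℝ (Fin n)).exists_isMinOn
    ⟨_, single_mem_stdSimplex ℝ (⟨0, hn⟩ : Fin n)⟩ hψ.continuousOn
  set c : Fin k → ℝ := fun l => z l - β l ⬝ᵥ y with hc
  -- First-order condition: `-c` is the gradient of the quadratic part of `ψ` in the bonuses at `y`,
  -- so `y` also minimizes the function with that part linearized.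
  have first : ∀ y' ∈ stdSimplex ℝ (Fin n),
      M y - ∑ l, c l * (β l ⬝ᵥ y) ≤ M y' - ∑ l, c l * (β l ⬝ᵥ y') := by
    intro y' hy'
    set D := ∑ l, (β l ⬝ᵥ y' - β l ⬝ᵥ y) ^ 2 with hD
    have step : ∀ t : ℝ, 0 < t → t ≤ 1 →
        M y - ∑ l, c l * (β l ⬝ᵥ y) ≤ M y' - ∑ l, c l * (β l ⬝ᵥ y') + t * (D / 2) := by
      intro t ht ht1
      have hmem : (1 - t) • y + t • y' ∈ stdSimplex ℝ (Fin n) :=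
        convex_stdSimplex ℝ _ hy hy' (by linarith) ht.le (by ring)
      have h1 : ψ y ≤ ψ ((1 - t) • y + t • y') := hmin hmem
      have h2 : M ((1 - t) • y + t • y') ≤ (1 - t) * M y + t * M y' := by
        refine Finset.sup'_le _ _ fun i _ => ?_
        simp only [Matrix.mulVec_add, Matrix.mulVec_smul, Pi.add_apply, Pi.smul_apply, smul_eq_mul]
        have a1 := mul_le_mul_of_nonneg_left (leM y i) (by linarith : 0 ≤ 1 - t)
        have a2 := mul_le_mul_of_nonneg_left (leM y' i) ht.le
        linarith
      have h3 : ∑ l, ((β l ⬝ᵥ ((1 - t) • y + t • y')) ^ 2 / 2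
            - z l * (β l ⬝ᵥ ((1 - t) • y + t • y'))) =
          ∑ l, ((β l ⬝ᵥ y) ^ 2 / 2 - z l * (β l ⬝ᵥ y)) +
          t * (∑ l, c l * (β l ⬝ᵥ y) - ∑ l, c l * (β l ⬝ᵥ y') + t * (D / 2)) := by
        rw [hD, Finset.sum_div, Finset.mul_sum, ← Finset.sum_sub_distrib, ← Finset.sum_add_distrib,
          Finset.mul_sum, ← Finset.sum_add_distrib]
        refine Finset.sum_congr rfl fun l _ => ?_
        simp only [dotProduct_add, dotProduct_smul, smul_eq_mul, hc]
        ring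
      simp only [ψ, h3] at h1
      have h4 : 0 ≤ t * (M y' - M y + (∑ l, c l * (β l ⬝ᵥ y) - ∑ l, c l * (β l ⬝ᵥ y')
          + t * (D / 2))) := by linarith
      have := nonneg_of_mul_nonneg_right h4 ht
      linarith
    by_contra! hlt
    set e := M y - ∑ l, c l * (β l ⬝ᵥ y) - (M y' - ∑ l, c l * (β l ⬝ᵥ y')) with he
    have he0 : 0 < e := by linarith
    have hD0 : 0 ≤ D := Finset.sum_nonneg fun l _ => sq_nonneg _
    -- This step size makes the second-order error `t * (D / 2)` smaller than the gap `e`.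
    have h1 := step (e / (e + D)) (by positivity) ((div_le_one (by positivity)).2 (by linarith))
    have h2 : e / (e + D) * (D / 2) < e := by
      rw [div_mul_eq_mul_div, div_lt_iff₀ (by positivity)]
      nlinarith
    linarith
  -- Subtracting the bonus from every row payoff puts `first` in the form needed for separation,
  -- which supplies the minimax strategy `x`.
  let T : (Fin n → ℝ) →ₗ[ℝ] (Fin m → ℝ) :=
    A.mulVecLin - LinearMap.pi fun _ => ∑ l, c l • (dotProductBilin ℝ ℝ (β l))
  have hT : ∀ y' i, T y' i = (A *ᵥ y') i - ∑ l, c l * (β l ⬝ᵥ y') := by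
    intro y' i
    simp [T]
  obtain ⟨x, hx, hsep⟩ := exists_mem_stdSimplex_forall_le_dotProduct
    (K := T '' stdSimplex ℝ (Fin n)) (s := M y - ∑ l, c l * (β l ⬝ᵥ y))
    ((convex_stdSimplex ℝ _).linear_image T) ⟨_, y, hy, rfl⟩ (by
      rintro _ ⟨y', hy', rfl⟩
      obtain ⟨i, -, hi⟩ := Finset.exists_mem_eq_sup' Finset.univ_nonempty fun i => (A *ᵥ y') i
      refine ⟨i, ?_⟩
      rw [hT, ← hi]
      exact first y' hy')
  have hsep' : ∀ y' ∈ stdSimplex ℝ (Fin n), M y - ∑ l, c l * (β l ⬝ᵥ y) ≤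
      x ⬝ᵥ (A *ᵥ y') - ∑ l, c l * (β l ⬝ᵥ y') := by
    intro y' hy'
    refine (hsep _ ⟨y', hy', rfl⟩).trans_eq ?_
    simp only [dotProduct, hT, mul_sub, Finset.sum_sub_distrib]
    rw [← Finset.sum_mul, hx.2, one_mul]
  have hMy : x ⬝ᵥ (A *ᵥ y) = M y :=
    le_antisymm (dotProduct_le_of_mem_stdSimplex hx (leM y)) (by linarith [hsep' y hy])
  refine ⟨x, y, hx, hy, fun i => hMy ▸ leM y i, fun j => ?_⟩
  have h1 := hsep' _ (single_mem_stdSimplex ℝ j)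
  have h2 := dotProduct_bonus A β c x (Pi.single j 1)
  rw [single_one_dotProduct] at h2
  rw [h2, hMy]
  linarith

end Optimal

/-- Projection along a compact factor is closed, and the preimage of `C` is the projection of the
part of the graph over `C`. -/
theorem continuous_of_isClosed_graph_of_compactSpace {X Y : Type*} [TopologicalSpace X]
    [TopologicalSpace Y] [CompactSpace Y] {f : X → Y} (h : IsClosed {p : X × Y | p.2 = f p.1}) :
    Continuous f := by
  refine continuous_iff_isClosed.2 fun C hC => ?_
  have := isClosedMap_fst_of_compactSpace _ (h.inter (hC.preimage continuous_snd))
  convert this using 1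
  ext a
  simp

/-! ### The homeomorphisms -/

section Homeomorph

variable {m n k : ℕ} {A : Matrix (Fin m) (Fin n) ℝ} {β : Fin k → Fin n → ℝ}

theorem isClosed_setOf_isParametricOptimal (A : Matrix (Fin m) (Fin n) ℝ) (β : Fin k → Fin n → ℝ) :
    IsClosed {p : (Fin k → ℝ) × (Fin m → ℝ) × (Fin n → ℝ) |
      IsParametricOptimal A β p.1 p.2.1 p.2.2} := by
  have e : {p : (Fin k → ℝ) × (Fin m → ℝ) × (Fin n → ℝ) |
      IsParametricOptimal A β p.1 p.2.1 p.2.2} =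
      {p | p.2.1 ∈ stdSimplex ℝ (Fin m)} ∩ {p | p.2.2 ∈ stdSimplex ℝ (Fin n)} ∩
      (⋂ i, {p | (A *ᵥ p.2.2) i ≤ p.2.1 ⬝ᵥ (A *ᵥ p.2.2)}) ∩
      ⋂ j, {p | (p.2.1 ᵥ* (-A)) j + ∑ l, β l j * p.1 l ≤
        -(p.2.1 ⬝ᵥ (A *ᵥ p.2.2)) + ∑ l, p.1 l * (β l ⬝ᵥ p.2.2)} := by
    ext p
    simp only [Set.mem_inter_iff, Set.mem_iInter, Set.mem_ofPred_eq]
    exact ⟨fun h => ⟨⟨⟨h.1, h.2⟩, h.3⟩, h.4⟩, fun h => ⟨h.1.1.1, h.1.1.2, h.1.2, h.2⟩⟩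
  have hA : Continuous fun p : (Fin k → ℝ) × (Fin m → ℝ) × (Fin n → ℝ) => A *ᵥ p.2.2 :=
    Continuous.matrix_mulVec continuous_const (by fun_prop)
  have hxA : Continuous fun p : (Fin k → ℝ) × (Fin m → ℝ) × (Fin n → ℝ) => p.2.1 ᵥ* (-A) :=
    Continuous.matrix_vecMul (by fun_prop) continuous_const
  have hv : Continuous fun p : (Fin k → ℝ) × (Fin m → ℝ) × (Fin n → ℝ) =>
      p.2.1 ⬝ᵥ (A *ᵥ p.2.2) := Continuous.dotProduct (by fun_prop) hA
  have hb : ∀ l, Continuous fun p : (Fin k → ℝ) × (Fin m → ℝ) × (Fin n → ℝ) => β l ⬝ᵥ p.2.2 :=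
    fun l => Continuous.dotProduct continuous_const (by fun_prop)
  rw [e]
  refine (((isClosed_stdSimplex ℝ _).preimage (by fun_prop)).inter
    ((isClosed_stdSimplex ℝ _).preimage (by fun_prop))).inter
    (isClosed_iInter fun i => ?_) |>.inter (isClosed_iInter fun j => ?_)
  · exact isClosed_le (by fun_prop) hv
  · exact isClosed_le (by fun_prop) (by fun_prop)

/-- The average of the entries of each vector of a family. -/
noncomputable def familyMean (α : Fin k → Fin m → ℝ) (l : Fin k) : ℝ := (∑ i, α l i) / m

theorem continuous_familyMean : Continuous (familyMean : (Fin k → Fin m → ℝ) → Fin k → ℝ) := by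
  unfold familyMean
  fun_prop

theorem familyMean_add (hm : 0 < m) (α : Fin k → Fin m → ℝ) (b : Fin k → ℝ) :
    familyMean (fun l i => α l i + b l) = familyMean α + b := by
  funext l
  have : (m : ℝ) ≠ 0 := by exact_mod_cast hm.ne'
  simp only [familyMean, Finset.sum_add_distrib, Finset.sum_const, Finset.card_univ,
    Fintype.card_fin, nsmul_eq_mul, Pi.add_apply]
  field_simp

theorem dotProduct_add_const {x : Fin m → ℝ} (hx : x ∈ stdSimplex ℝ (Fin m)) (a : Fin m → ℝ)
    (b : ℝ) : x ⬝ᵥ (fun i => a i + b) = x ⬝ᵥ a + b := by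
  simp only [dotProduct, mul_add, Finset.sum_add_distrib, ← Finset.sum_mul, hx.2, one_mul]

/-- The homeomorphism of the Nash equilibrium correspondence with the parameter space. It keeps the
deviations of each `α l` from its mean, and replaces the mean by the expected value `x ⬝ᵥ α l` plus
the expected bonus `β l ⬝ᵥ y`. -/
theorem nonempty_homeomorph_nashCorrespondence (hm : 0 < m) (hn : 0 < n)
    (hβ : LinearIndependent ℝ β) (hP : Nondegenerate (polyP A) (labelP A) n)
    (hQ : Nondegenerate (polyQ A β) (labelQ A β) (m + k)) :
    Nonempty (nashCorrespondence A β ≃ₜ (Fin k → Fin m → ℝ)) := by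
  have hex : ∀ γ : Fin k → Fin m → ℝ, ∃ s : stdSimplex ℝ (Fin m) × stdSimplex ℝ (Fin n),
      IsParametricOptimal A β (fun l => familyMean γ l - β l ⬝ᵥ (s.2 : Fin n → ℝ)) s.1 s.2 := by
    intro γ
    obtain ⟨x, y, h⟩ := exists_isParametricOptimal hm hn A β (familyMean γ)
    exact ⟨(⟨x, h.left_mem⟩, ⟨y, h.right_mem⟩), h⟩
  choose s hs using hex
  have huniq : ∀ (γ : Fin k → Fin m → ℝ) (x : Fin m → ℝ) (y : Fin n → ℝ),
      IsParametricOptimal A β (fun l => familyMean γ l - β l ⬝ᵥ y) x y →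
        x = (s γ).1 ∧ y = (s γ).2 := fun γ x y h =>
    h.unique hP hQ hβ (hs γ) fun l => by ring
  have : CompactSpace (stdSimplex ℝ (Fin m)) :=
    isCompact_iff_compactSpace.1 (isCompact_stdSimplex ℝ (Fin m))
  have : CompactSpace (stdSimplex ℝ (Fin n)) :=
    isCompact_iff_compactSpace.1 (isCompact_stdSimplex ℝ (Fin n))
  have hb : ∀ l, Continuous fun y : Fin n → ℝ => β l ⬝ᵥ y :=
    fun l => Continuous.dotProduct continuous_const continuous_id
  have hmean : ∀ l, Continuous fun γ : Fin k → Fin m → ℝ => familyMean γ l :=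
    fun l => (continuous_apply l).comp continuous_familyMean
  have hscont : Continuous s := by
    refine continuous_of_isClosed_graph_of_compactSpace ?_
    -- By uniqueness, solving the closed optimality conditions characterizes the graph of `s`.
    have e : {p : (Fin k → Fin m → ℝ) × stdSimplex ℝ (Fin m) × stdSimplex ℝ (Fin n) |
        p.2 = s p.1} = (fun p => ((fun l => familyMean p.1 l - β l ⬝ᵥ (p.2.2 : Fin n → ℝ)),
          (p.2.1 : Fin m → ℝ), (p.2.2 : Fin n → ℝ))) ⁻¹'
        {p | IsParametricOptimal A β p.1 p.2.1 p.2.2} := by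
      ext ⟨γ, x, y⟩
      constructor
      · intro h
        have h' : (x, y) = s γ := h
        have := hs γ
        rw [← h'] at this
        exact this
      · intro h
        have := huniq γ x y h
        exact Prod.ext (Subtype.ext this.1) (Subtype.ext this.2)
    rw [e]
    refine (isClosed_setOf_isParametricOptimal A β).preimage ?_
    have h1 : ∀ l, Continuous fun p : (Fin k → Fin m → ℝ) × stdSimplex ℝ (Fin m) ×
        stdSimplex ℝ (Fin n) => β l ⬝ᵥ (p.2.2 : Fin n → ℝ) := fun l =>
      (hb l).comp (by fun_prop)
    have h2 : ∀ l, Continuous fun p : (Fin k → Fin m → ℝ) × stdSimplex ℝ (Fin m) ×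
        stdSimplex ℝ (Fin n) => familyMean p.1 l := fun l => (hmean l).comp (by fun_prop)
    fun_prop
  -- Adding a constant to `α l` shifts its mean and its expected value under `x` equally. The
  -- forward shift makes the mean `x ⬝ᵥ α l + β l ⬝ᵥ y`; the backward shift makes the expected value
  -- `familyMean γ l - β l ⬝ᵥ y`.
  refine ⟨⟨⟨fun p l i => p.1.1 l i + (p.1.2.1 ⬝ᵥ p.1.1 l + β l ⬝ᵥ p.1.2.2 - familyMean p.1.1 l),
    fun γ => ⟨(fun l i => γ l i + (familyMean γ l - β l ⬝ᵥ ((s γ).2 : Fin n → ℝ)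
      - ((s γ).1 : Fin m → ℝ) ⬝ᵥ γ l), (s γ).1, (s γ).2), ?_⟩, ?_, ?_⟩, ?_, ?_⟩⟩
  · refine isNash_colPayoff_iff.2 ?_
    have := hs γ
    convert this using 2 with l
    simp only [dotProduct_add_const (x := ⇑(s γ).1) (s γ).1.2]
    ring
  · rintro ⟨⟨α, x, y⟩, hp⟩
    have hopt : IsParametricOptimal A β (fun l => x ⬝ᵥ α l) x y := isNash_colPayoff_iff.1 hp
    set γ : Fin k → Fin m → ℝ :=
      fun l i => α l i + (x ⬝ᵥ α l + β l ⬝ᵥ y - familyMean α l) with hγ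
    have hmγ : ∀ l, familyMean γ l = x ⬝ᵥ α l + β l ⬝ᵥ y := fun l => by
      rw [hγ, familyMean_add hm α fun l => x ⬝ᵥ α l + β l ⬝ᵥ y - familyMean α l]
      simp
    obtain ⟨hx, hy⟩ := huniq γ x y (by simpa [hmγ] using hopt)
    refine Subtype.ext (Prod.ext ?_ (Prod.ext hx.symm hy.symm))
    funext l i
    change γ l i + (familyMean γ l - β l ⬝ᵥ ((s γ).2 : Fin n → ℝ)
      - ((s γ).1 : Fin m → ℝ) ⬝ᵥ γ l) = α l i
    rw [← hx, ← hy, hmγ, hγ]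
    simp only [dotProduct_add_const hopt.left_mem]
    ring
  · intro γ
    funext l i
    have hmα := congrFun (familyMean_add hm γ fun l => familyMean γ l -
      β l ⬝ᵥ ((s γ).2 : Fin n → ℝ) - ((s γ).1 : Fin m → ℝ) ⬝ᵥ γ l) l
    simp only [hmα, dotProduct_add_const (x := ⇑(s γ).1) (s γ).1.2, Pi.add_apply]
    ring
  · have h1 : ∀ l, Continuous fun p : nashCorrespondence A β => p.1.2.1 ⬝ᵥ p.1.1 l := fun l =>
      Continuous.dotProduct (by fun_prop) (by fun_prop)
    have h2 : ∀ l, Continuous fun p : nashCorrespondence A β => β l ⬝ᵥ p.1.2.2 := fun l =>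
      (hb l).comp (by fun_prop)
    have h3 : ∀ l, Continuous fun p : nashCorrespondence A β => familyMean p.1.1 l := fun l =>
      (hmean l).comp (by fun_prop)
    change Continuous fun (p : nashCorrespondence A β) l i =>
      p.1.1 l i + (p.1.2.1 ⬝ᵥ p.1.1 l + β l ⬝ᵥ p.1.2.2 - familyMean p.1.1 l)
    fun_prop
  · have h0 : Continuous fun γ => ((s γ).1 : Fin m → ℝ) := by fun_prop
    have h0' : Continuous fun γ => ((s γ).2 : Fin n → ℝ) := by fun_prop
    have h1 : ∀ l, Continuous fun γ : Fin k → Fin m → ℝ => ((s γ).1 : Fin m → ℝ) ⬝ᵥ γ l := fun l =>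
      Continuous.dotProduct h0 (by fun_prop)
    have h2 : ∀ l, Continuous fun γ => β l ⬝ᵥ ((s γ).2 : Fin n → ℝ) := fun l => (hb l).comp h0'
    refine Continuous.subtype_mk ?_ _
    fun_prop

/-- Each row of the perturbation is a combination of the `β l`, so independence recovers its
coefficients `α l i`. -/
theorem colPayoff_injective (A : Matrix (Fin m) (Fin n) ℝ) (hβ : LinearIndependent ℝ β) :
    Function.Injective (colPayoff A β) := by
  intro α α' h
  have h1 := add_left_cancel h
  have h2 : ∀ i, ∑ l, (α l i - α' l i) • β l = 0 := fun i => by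
    funext j
    have := congrFun (congrFun h1 i) j
    simp only [Matrix.sum_apply, Matrix.vecMulVec_apply] at this
    simp [sub_mul, Finset.sum_sub_distrib, this]
  funext l i
  exact sub_eq_zero.1 (Fintype.linearIndependent_iff.1 hβ _ (h2 i) l)

/-- The game space is homeomorphic to its parameter space. -/
theorem nonempty_homeomorph_gameSpace (A : Matrix (Fin m) (Fin n) ℝ)
    (hβ : LinearIndependent ℝ β) :
    Nonempty (gameSpace A β ≃ₜ (Fin k → Fin m → ℝ)) := by
  let F : (Fin k → Fin m → ℝ) →ₗ[ℝ] Matrix (Fin m) (Fin n) ℝ :=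
    { toFun := fun α => ∑ l, Matrix.vecMulVec (α l) (β l)
      map_add' := fun α α' => by
        simp [Matrix.add_vecMulVec, Finset.sum_add_distrib]
      map_smul' := fun t α => by
        simp [Matrix.smul_vecMulVec, Finset.smul_sum] }
  have hF : Function.Injective F := fun α α' h =>
    colPayoff_injective A hβ (congrArg (-A + ·) h)
  have hemb : Topology.IsEmbedding (colPayoff A β) :=
    (Homeomorph.addLeft (-A)).isEmbedding.comp
      (LinearMap.isClosedEmbedding_of_injective (LinearMap.ker_eq_bot.2 hF)).isEmbedding
  have hpair : Topology.IsEmbedding fun α => (A, colPayoff A β α) :=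
    (isEmbedding_prodMkRight A).comp hemb
  have hrange : Set.range (fun α => (A, colPayoff A β α)) = gameSpace A β := by
    ext G
    simp [gameSpace, eq_comm]
  exact ⟨(Homeomorph.setCongr hrange.symm).trans hpair.toHomeomorph.symm⟩

end Homeomorph
theorem mainTheorem3 (m n k : ℕ) (hm : 0 < m) (hn : 0 < n)
    (A : Matrix (Fin m) (Fin n) ℝ) (β : Fin k → Fin n → ℝ)
    (hβ : LinearIndependent ℝ β)
    (hP : Nondegenerate (polyP A) (labelP A) n)
    (hQ : Nondegenerate (polyQ A β) (labelQ A β) (m + k)) :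
    Nonempty (nashCorrespondence A β ≃ₜ gameSpace A β) ∧
      Nonempty (gameSpace A β ≃ₜ (Fin (k * m) → ℝ)) := by
  obtain ⟨e₁⟩ := nonempty_homeomorph_nashCorrespondence hm hn hβ hP hQ
  obtain ⟨e₂⟩ := nonempty_homeomorph_gameSpace A hβ
  have hdim : Module.finrank ℝ (Fin k → Fin m → ℝ) = Module.finrank ℝ (Fin (k * m) → ℝ) := by
    simp [Module.finrank_pi_fintype]
  exact ⟨⟨e₁.trans e₂.symm⟩,
    ⟨e₂.trans (ContinuousLinearEquiv.ofFinrankEq hdim).toHomeomorph⟩⟩
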